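/- **Conventions.** The *length* of a finite poset is the largest $n$ such that it contains a chain of $n+1$ elements; the *height* of an element $x$ of a finite lattice $L$ is the length of $\{u\in L:u\le x\}$. A finite lattice is *slim* if the set $J(L)$ of its nonzero join-irreducible elements is the union of two chains. A *slim rectangular lattice* is a finite slim semimodular lattice $L$ in which exactly two elements are both (nonzero) join-irreducible and (non-unit) meet-irreducible, and these two elements are complementary. A *4-cell* of $L$ is a cover-preserving 4-element Boolean sublattice $H=\{0_H,a,b,1_H\}$ with $a\wedge b=0_H$ and $a\vee b=1_H$; it is *distributive* if the principal ideal $\{u\in L:u\le 1_H\}$ is a distributive lattice. **Multifork extension.** Let $H=\{0_H,a,b,1_H\}$ be a 4-cell of $L$ and $k\ge 1$ an integer. For edges (prime intervals) of $L$ write $[u,w]\to[x,z]$ if $\{x,u,z,w\}$ is a 4-cell with bottom $x$, top $w$ and $u\ne z$ in the middle. Let $E_a$ be the set of all edges reachable from $[0_H,a]$ by finitely many (possibly zero) steps $\to$, and define $E_b$ from $[0_H,b]$ in the same way. The poset $L'$ obtained from $L$ by *inserting a $k$-fold multifork into $H$* consists of the elements of $L$, new elements $\ell_{e,i}$ for $e\in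 E_a$ and $r_{e,i}$ for $e\in E_b$ ($1\le i\le k$), and new elements $m_{i,j}$ ($1\le i\le j\le k$). Its order is the reflexive transitive closure of the order of $L$ together with the following relations: - $x\le \ell_{e,k}\le\dots\le \ell_{e,1}\le z$ for $e=[x,z]\in E_a$, and $x\le r_{e,1}\le\dots\le r_{e,k}\le z$ for $e=[x,z]\in E_b$; - $\ell_{f,i}\le \ell_{e,i}$ for $e,f\in E_a$ with $e\to f$, and $r_{f,i}\le r_{e,i}$ for $e,f\in E_b$ with $e\to f$; - $\ell_{[0_H,a],j}\le m_{i,j}$, $\ r_{[0_H,b],i}\le m_{i,j}$, and $m_{i,j}\le 1_H$ for $i\le j$; - $m_{i,j}\le m_{i',j'}$ whenever $i\le i'\le j'\le j$. **Lemma.** Let $L$ be a slim rectangular lattice, let $H$ be a distributive 4-cell of $L$, let $k$ be a positive integer, and let $L'$ be obtained from $L$ by inserting a $k$-fold multifork into $H$. Then $L'$ is a slim rectangular lattice, $$|L'|=|L|+k\cdot\operatorname{height}(1_H)+\frac{k(k+1)}2,\qquad\text{and}\qquad \operatorname{length}(L')=\operatorname{length}(L)+k,$$ where the height of $1_H$ is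 taken in $L$. -/

import Mathlib

/-- A lattice is *slim rectangular* if it is finite, slim (its nonzero join-irreducible elements form
the union of two chains), semimodular, it has exactly two *corners* (elements that are both
join-irreducible and meet-irreducible), and the two corners are complementary. -/
structure IsSlimRectangular (L : Type*) [Lattice L] : Prop where
  finite : Finite L
  slim : ∃ C D : Set L, IsChain (· ≤ ·) C ∧ IsChain (· ≤ ·) D ∧ {x : L | SupIrred x} = C ∪ D
  semimodular : IsUpperModularLattice L
  corners : ∃ u v : L, u ≠ v ∧ {x : L | SupIrred x ∧ InfIrred x} = {u, v} ∧
    IsBot (u ⊓ v) ∧ IsTop (u ⊔ v)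

/-- A *4-cell*: a cover-preserving 4-element Boolean sublattice `{bot, left, right, top}`. -/
structure FourCell (L : Type*) [Lattice L] where
  bot : L
  left : L
  right : L
  top : L
  left_inf_right : left ⊓ right = bot
  left_sup_right : left ⊔ right = top
  bot_covBy_left : bot ⋖ left
  bot_covBy_right : bot ⋖ right
  left_covBy_top : left ⋖ top
  right_covBy_top : right ⋖ top

namespace FourCell

/-- A 4-cell is *distributive* if the principal ideal generated by its top is distributive. -/
def IsDistributive {L : Type*} [Lattice L] (H : FourCell L) : Prop :=
  ∀ x y z : L, x ≤ H.top → y ≤ H.top → z ≤ H.top → x ⊓ (y ⊔ z) = (x ⊓ y) ⊔ (x ⊓ z)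

/-- One downward step of a trajectory: `e` is an upper edge of some 4-cell and `f` is the opposite
(lower) edge of the same 4-cell. An edge `x ⋖ z` is represented by the pair `(x, z)`. -/
def StepDown {L : Type*} [Lattice L] (e f : L × L) : Prop :=
  ∃ T : FourCell L, e = (T.left, T.top) ∧ f = (T.bot, T.right)

/-- The edges reached by descending, 4-cell by 4-cell, from the lower left edge of `H`
(this edge included). -/
def leftEdges {L : Type*} [Lattice L] (H : FourCell L) : Set (L × L) :=
  {e | Relation.ReflTransGen StepDown (H.bot, H.left) e}

/-- The edges reached by descending, 4-cell by 4-cell, from the lower right edge of `H`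
(this edge included). -/
def rightEdges {L : Type*} [Lattice L] (H : FourCell L) : Set (L × L) :=
  {e | Relation.ReflTransGen StepDown (H.bot, H.right) e}

/-- The elements of the lattice obtained by inserting a `k`-fold multifork into the 4-cell `H`:

* the old elements;
* `k` new elements on each edge of `H.leftEdges` and on each edge of `H.rightEdges`;
* `k (k + 1) / 2` new elements inside `H`. If `t₀, …, tₖ₋₁` (from left to right) denote the new
  lower covers of `H.top`, then `inner i j` is `tᵢ ∧ ⋯ ∧ tⱼ`; on the lower left edge of `H` the
  element `onLeft _ j` is `H.left ∧ t₀ ∧ ⋯ ∧ tⱼ`, and on the lower right edge of `H` the element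
  `onRight _ i` is `tᵢ ∧ ⋯ ∧ tₖ₋₁ ∧ H.right`. -/
inductive MultiforkExtension {L : Type*} [Lattice L] (H : FourCell L) (k : ℕ)
  | old (x : L)
  | onLeft (e : L × L) (he : e ∈ H.leftEdges) (i : Fin k)
  | onRight (e : L × L) (he : e ∈ H.rightEdges) (i : Fin k)
  | inner (i j : Fin k) (hij : i ≤ j)

namespace MultiforkExtension

/-- The relations that generate the order of the multifork extension. -/
inductive Step {L : Type*} [Lattice L] {H : FourCell L} {k : ℕ} :
    MultiforkExtension H k → MultiforkExtension H k → Prop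
  /-- the old order is kept -/
  | old_old (x y : L) (hxy : x ≤ y) : Step (old x) (old y)
  /-- the new elements on the edge `x ⋖ z` form a chain between `x` and `z` -/
  | old_onLeft (e : L × L) (he : e ∈ H.leftEdges) (i : Fin k) : Step (old e.1) (onLeft e he i)
  | onLeft_old (e : L × L) (he : e ∈ H.leftEdges) (i : Fin k) : Step (onLeft e he i) (old e.2)
  | onLeft_chain (e : L × L) (he : e ∈ H.leftEdges) (i i' : Fin k) (h : i' ≤ i) :
      Step (onLeft e he i) (onLeft e he i')
  | old_onRight (e : L × L) (he : e ∈ H.rightEdges) (i : Fin k) : Step (old e.1) (onRight e he i)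
  | onRight_old (e : L × L) (he : e ∈ H.rightEdges) (i : Fin k) : Step (onRight e he i) (old e.2)
  | onRight_chain (e : L × L) (he : e ∈ H.rightEdges) (i i' : Fin k) (h : i ≤ i') :
      Step (onRight e he i) (onRight e he i')
  /-- on two opposite edges of a 4-cell, the corresponding new elements are connected -/
  | onLeft_cross (e f : L × L) (he : e ∈ H.leftEdges) (hf : f ∈ H.leftEdges)
      (hef : StepDown e f) (i : Fin k) : Step (onLeft f hf i) (onLeft e he i)
  | onRight_cross (e f : L × L) (he : e ∈ H.rightEdges) (hf : f ∈ H.rightEdges)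
      (hef : StepDown e f) (i : Fin k) : Step (onRight f hf i) (onRight e he i)
  /-- the new elements on the two lower edges of `H` are connected to those inside `H` -/
  | onLeft_inner (he : (H.bot, H.left) ∈ H.leftEdges) (i j : Fin k) (hij : i ≤ j) :
      Step (onLeft (H.bot, H.left) he j) (inner i j hij)
  | onRight_inner (he : (H.bot, H.right) ∈ H.rightEdges) (i j : Fin k) (hij : i ≤ j) :
      Step (onRight (H.bot, H.right) he i) (inner i j hij)
  /-- inside `H`, a shorter meet `tᵢ ∧ ⋯ ∧ tⱼ` is larger -/
  | inner_inner (i j i' j' : Fin k) (hij : i ≤ j) (hij' : i' ≤ j') (hi : i ≤ i') (hj : j' ≤ j) :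
      Step (inner i j hij) (inner i' j' hij')
  | inner_old (i j : Fin k) (hij : i ≤ j) : Step (inner i j hij) (old H.top)

end MultiforkExtension

theorem covBy_of_mem_leftEdges {L : Type*} [Lattice L] {H : FourCell L} {e : L × L}
    (he : e ∈ H.leftEdges) : e.1 ⋖ e.2 := by
  rcases Relation.ReflTransGen.cases_tail he with h | ⟨f, -, T, -, h⟩
  · rw [h]; exact H.bot_covBy_left
  · rw [h]; exact T.bot_covBy_right

theorem covBy_of_mem_rightEdges {L : Type*} [Lattice L] {H : FourCell L} {e : L × L}
    (he : e ∈ H.rightEdges) : e.1 ⋖ e.2 := by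
  rcases Relation.ReflTransGen.cases_tail he with h | ⟨f, -, T, -, h⟩
  · rw [h]; exact H.bot_covBy_right
  · rw [h]; exact T.bot_covBy_right

namespace MultiforkExtension

/-- Auxiliary rank, used only to see that the generated relation is antisymmetric. -/
def rank {L : Type*} [Lattice L] {H : FourCell L} {k : ℕ} : MultiforkExtension H k → L ×ₗ ℕ
  | old x => toLex (x, k)
  | onLeft e _ i => toLex (e.2, k - 1 - i)
  | onRight e _ i => toLex (e.2, i)
  | inner i j _ => toLex (H.top, k - 1 - (j - i))

theorem Step.eq_or_rank_lt {L : Type*} [Lattice L] {H : FourCell L} {k : ℕ}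
    {a b : MultiforkExtension H k} (h : Step a b) : a = b ∨ rank a < rank b := by
  induction h with
  | old_old x y hxy =>
    rcases hxy.eq_or_lt with rfl | h
    · exact Or.inl rfl
    · exact Or.inr (Prod.Lex.toLex_lt_toLex.2 (Or.inl h))
  | old_onLeft e he i =>
    exact Or.inr (Prod.Lex.toLex_lt_toLex.2 (Or.inl (covBy_of_mem_leftEdges he).lt))
  | onLeft_old e he i =>
    exact Or.inr (Prod.Lex.toLex_lt_toLex.2 (Or.inr ⟨rfl, by dsimp only; omega⟩))
  | onLeft_chain e he i i' h =>
    rcases h.eq_or_lt with rfl | h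
    · exact Or.inl rfl
    · exact Or.inr (Prod.Lex.toLex_lt_toLex.2 (Or.inr ⟨rfl, by dsimp only; omega⟩))
  | old_onRight e he i =>
    exact Or.inr (Prod.Lex.toLex_lt_toLex.2 (Or.inl (covBy_of_mem_rightEdges he).lt))
  | onRight_old e he i =>
    exact Or.inr (Prod.Lex.toLex_lt_toLex.2 (Or.inr ⟨rfl, by dsimp only; omega⟩))
  | onRight_chain e he i i' h =>
    rcases h.eq_or_lt with rfl | h
    · exact Or.inl rfl
    · exact Or.inr (Prod.Lex.toLex_lt_toLex.2 (Or.inr ⟨rfl, by dsimp only; omega⟩))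
  | onLeft_cross e f he hf hef i =>
    obtain ⟨T, rfl, rfl⟩ := hef
    exact Or.inr (Prod.Lex.toLex_lt_toLex.2 (Or.inl T.right_covBy_top.lt))
  | onRight_cross e f he hf hef i =>
    obtain ⟨T, rfl, rfl⟩ := hef
    exact Or.inr (Prod.Lex.toLex_lt_toLex.2 (Or.inl T.right_covBy_top.lt))
  | onLeft_inner he i j hij =>
    exact Or.inr (Prod.Lex.toLex_lt_toLex.2 (Or.inl H.left_covBy_top.lt))
  | onRight_inner he i j hij =>
    exact Or.inr (Prod.Lex.toLex_lt_toLex.2 (Or.inl H.right_covBy_top.lt))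
  | inner_inner i j i' j' hij hij' hi hj =>
    by_cases h : i = i' ∧ j = j'
    · obtain ⟨rfl, rfl⟩ := h
      exact Or.inl rfl
    · exact Or.inr (Prod.Lex.toLex_lt_toLex.2 (Or.inr ⟨rfl, by dsimp only; omega⟩))
  | inner_old i j hij =>
    exact Or.inr (Prod.Lex.toLex_lt_toLex.2 (Or.inr ⟨rfl, by dsimp only; omega⟩))

theorem eq_or_rank_lt {L : Type*} [Lattice L] {H : FourCell L} {k : ℕ}
    {a b : MultiforkExtension H k} (h : Relation.ReflTransGen Step a b) :
    a = b ∨ rank a < rank b := by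
  induction h with
  | refl => exact Or.inl rfl
  | tail _ h ih =>
    rcases ih with rfl | ih
    · exact h.eq_or_rank_lt
    · rcases h.eq_or_rank_lt with rfl | h'
      · exact Or.inr ih
      · exact Or.inr (ih.trans h')

/-- The order of the multifork extension: the reflexive transitive closure of `Step`. -/
instance {L : Type*} [Lattice L] {H : FourCell L} {k : ℕ} :
    PartialOrder (MultiforkExtension H k) where
  le := Relation.ReflTransGen Step
  le_refl _ := Relation.ReflTransGen.refl
  le_trans _ _ _ := Relation.ReflTransGen.trans
  le_antisymm a b hab hba := by
    rcases eq_or_rank_lt hab with h | h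
    · exact h
    · rcases eq_or_rank_lt hba with h' | h'
      · exact h'.symm
      · exact absurd (h.trans h') (lt_irrefl _)

end MultiforkExtension

end FourCell

/-!
In a finite slim semimodular lattice, an element is determined by the numbers of join-irreducible
elements below it in the two chains. For a slim rectangular lattice this puts the elements on a grid
`{0, …, M} × {0, …, N}` with the componentwise order, and slim rectangular lattices are exactly the
subsets of such a grid that contain its two lower edges and its top, are closed under meets, and
satisfy a condition expressing semimodularity.

A distributive 4-cell `H` is the top unit square of a rectangle `{0, …, m} × {0, …, n}` all of whose
points are occupied, where `(m, n)` are the coordinates of `H.top`; thus `H.top` has height `m + n`,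
and the two trajectories starting at `H` run straight down to the lower edges of the grid. A
`k`-fold multifork inserts `k` columns before the `m`-th one and `k` rows before the `n`-th one, and
occupies all new points below a staircase. The grid conditions survive this.

In a semimodular lattice the coheight drops by one along every covering, so the length of a slim
rectangular lattice is `coheight x + f x` for every `x` with coordinates `(f x, 0)`. For `x` at
`(m, 0)`, everything above `x` in the multifork extension is old, so the coheight of `x` is
unchanged, while its first coordinate increases from `m` to `m + k`.
-/

section Order

variable {P : Type*}

theorem exists_lattice_of_exists_isGLB [PartialOrder P] [Finite P]
    (exists_inf : ∀ x y : P, ∃ z, IsGLB {x, y} z) (exists_top : ∃ t : P, IsTop t) :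
    ∃ inst : Lattice P, inst.toSemilatticeSup.toPartialOrder = ‹PartialOrder P› := by
  choose inf hinf using exists_inf
  have exists_sup (x y : P) : ∃ z, IsLUB {x, y} z := by
    obtain ⟨t, ht⟩ := exists_top
    obtain ⟨z, hz⟩ :=
      (Set.toFinite (upperBounds {x, y})).exists_minimal ⟨t, fun w _ => ht w⟩
    refine ⟨z, hz.prop, fun w hw => ?_⟩
    have inf_mem : inf z w ∈ upperBounds {x, y} := fun a ha =>
      (hinf z w).2 (by rintro _ (rfl | rfl); exacts [hz.prop ha, hw ha])
    exact (hz.le_of_le inf_mem ((hinf z w).1 (by simp))).trans ((hinf z w).1 (by simp))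
  choose sup hsup using exists_sup
  exact ⟨Lattice.ofIsLUBofIsGLB sup inf hsup hinf, rfl⟩

theorem coheight_eq_add_one_of_covBy [Lattice P] [IsWeakUpperModularLattice P]
    [WellFoundedGT P] [IsStronglyAtomic P] {x y : P} (hxy : x ⋖ y) :
    Order.coheight x = Order.coheight y + 1 := by
  induction x using WellFoundedGT.induction generalizing y with
  | _ x ih =>
    refine le_antisymm ?_ (Order.coheight_add_one_le hxy.lt)
    rw [Order.coheight_eq_iSup_gt_coheight]
    refine iSup₂_le fun z hxz => ?_
    obtain ⟨a, hxa, haz⟩ := exists_covBy_le_of_lt hxz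
    suffices Order.coheight a ≤ Order.coheight y by
      exact add_le_add_left ((Order.coheight_anti haz).trans this) 1
    rcases eq_or_ne a y with rfl | hne
    · exact le_rfl
    · have hinf : a ⊓ y = x :=
        (hxa.eq_or_eq (le_inf hxa.le hxy.le) inf_le_left).resolve_right fun h =>
          hne ((hxy.eq_or_eq hxa.le (inf_eq_left.1 h)).resolve_left hxa.ne')
      have ha : a ⋖ a ⊔ y := covBy_sup_of_inf_covBy_of_inf_covBy_left (hinf ▸ hxa) (hinf ▸ hxy)
      have hy : y ⋖ a ⊔ y := covBy_sup_of_inf_covBy_of_inf_covBy_right (hinf ▸ hxa) (hinf ▸ hxy)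
      rw [ih a hxa.lt ha, ih y hxy.lt hy]

theorem height_eq_of_exists_add_one_eq [Preorder P] {r : P → ℕ} (hr : StrictMono r) {t : P}
    (exists_lt : ∀ x ≤ t, 0 < r x → ∃ y < x, r y + 1 = r x) : Order.height t = r t := by
  refine le_antisymm
    ((Order.height_le_height_apply_of_strictMono r hr t).trans_eq (Order.height_nat _)) ?_
  suffices ∀ n, ∀ x ≤ t, r x = n → (n : ℕ∞) ≤ Order.height x from this _ t le_rfl rfl
  intro n
  induction n with
  | zero => simp
  | succ n ih =>
    intro x hx hxn
    obtain ⟨y, hyx, hy⟩ := exists_lt x hx (by omega)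
    push_cast
    exact (add_le_add_left (ih y (hyx.le.trans hx) (by omega)) 1).trans
      (Order.height_add_one_le hyx)

theorem le_of_forall_supIrred_le [SemilatticeSup P] [OrderBot P] [WellFoundedLT P] {x y : P}
    (h : ∀ c, SupIrred c → c ≤ x → c ≤ y) : x ≤ y := by
  obtain ⟨s, rfl, hs⟩ := exists_supIrred_decomposition x
  exact Finset.sup_le fun c hc => h c (hs hc) (Finset.le_sup (f := id) hc)

end Order

/-! ### Grid coordinates -/

/-- The points of the poset `P` are put on the grid `{0, …, M} × {0, …, N}` by their coordinates
`f` and `g`: the order of `P` is componentwise, and the image is closed under meets and contains the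
top and the two lower edges of the grid. The conditions `exists_right` and `exists_above` express
semimodularity: if `z` lies above `x` in the same column, which is not the last one, then some
element above `x` lies to the right of this column and below the row of `z`. -/
structure IsGridCoordinates {P : Type*} [PartialOrder P] (f g : P → ℕ) (M N : ℕ) : Prop where
  pos_fst : 0 < M
  pos_snd : 0 < N
  le_iff : ∀ {x y : P}, x ≤ y ↔ f x ≤ f y ∧ g x ≤ g y
  exists_inf : ∀ x y : P, ∃ z, f z = min (f x) (f y) ∧ g z = min (g x) (g y)
  exists_top : ∃ t, f t = M ∧ g t = N
  le_fst : ∀ x, f x ≤ M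
  le_snd : ∀ x, g x ≤ N
  exists_fst : ∀ i ≤ M, ∃ x, f x = i ∧ g x = 0
  exists_snd : ∀ j ≤ N, ∃ x, f x = 0 ∧ g x = j
  exists_right : ∀ {x z : P}, f x = f z → g x < g z → f x < M →
    ∃ w, f x < f w ∧ g x ≤ g w ∧ g w < g z
  exists_above : ∀ {x z : P}, g x = g z → f x < f z → g x < N →
    ∃ w, g x < g w ∧ f x ≤ f w ∧ f w < f z

namespace IsGridCoordinates

section Poset

variable {P : Type*} [PartialOrder P] {f g : P → ℕ} {M N : ℕ} {x y : P}

theorem swap (c : IsGridCoordinates f g M N) : IsGridCoordinates g f N M where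
  pos_fst := c.pos_snd
  pos_snd := c.pos_fst
  le_iff := c.le_iff.trans and_comm
  exists_inf x y := (c.exists_inf x y).imp fun _ => And.symm
  exists_top := c.exists_top.imp fun _ => And.symm
  le_fst := c.le_snd
  le_snd := c.le_fst
  exists_fst i hi := (c.exists_snd i hi).imp fun _ => And.symm
  exists_snd i hi := (c.exists_fst i hi).imp fun _ => And.symm
  exists_right := c.exists_above
  exists_above := c.exists_right

theorem ext (c : IsGridCoordinates f g M N) (hf : f x = f y) (hg : g x = g y) : x = y :=
  le_antisymm (c.le_iff.2 ⟨hf.le, hg.le⟩) (c.le_iff.2 ⟨hf.ge, hg.ge⟩)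

theorem lt_iff (c : IsGridCoordinates f g M N) :
    x < y ↔ f x ≤ f y ∧ g x ≤ g y ∧ (f x < f y ∨ g x < g y) := by
  rw [lt_iff_le_not_ge, c.le_iff, c.le_iff]
  omega

theorem fst_mono (c : IsGridCoordinates f g M N) : Monotone f := fun _ _ h => (c.le_iff.1 h).1

theorem snd_mono (c : IsGridCoordinates f g M N) : Monotone g := fun _ _ h => (c.le_iff.1 h).2

theorem strictMono_add (c : IsGridCoordinates f g M N) : StrictMono (f + g) := by
  intro x y hxy
  rw [c.lt_iff] at hxy
  simp only [Pi.add_apply]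
  omega

theorem finite (c : IsGridCoordinates f g M N) : Finite P :=
  Finite.of_injective (β := Set.Iic (M, N)) (fun x => ⟨(f x, g x), c.le_fst x, c.le_snd x⟩)
    fun _ _ h => c.ext (congrArg (·.1.1) h) (congrArg (·.1.2) h)

theorem covBy_of_fst_add_one_eq (c : IsGridCoordinates f g M N) (hf : f x + 1 = f y)
    (hg : g x = g y) : x ⋖ y := by
  refine ⟨c.lt_iff.2 (by omega), fun z hxz hzy => ?_⟩
  rw [c.lt_iff] at hxz hzy
  omega

theorem le_total_of_snd_eq (c : IsGridCoordinates f g M N) (hxy : g x = g y) :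
    x ≤ y ∨ y ≤ x := by
  rw [c.le_iff, c.le_iff]
  omega

theorem exists_lattice (c : IsGridCoordinates f g M N) :
    ∃ inst : Lattice P, inst.toSemilatticeSup.toPartialOrder = ‹PartialOrder P› := by
  have := c.finite
  refine exists_lattice_of_exists_isGLB (fun x y => ?_) ?_
  · obtain ⟨z, hf, hg⟩ := c.exists_inf x y
    refine ⟨z, ?_, fun w hw => ?_⟩
    · rintro _ (rfl | rfl) <;> exact c.le_iff.2 (by omega)
    · have hx := c.le_iff.1 (hw (by simp) : w ≤ x)
      have hy := c.le_iff.1 (hw (by simp) : w ≤ y)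
      exact c.le_iff.2 (by omega)
  · obtain ⟨t, rfl, rfl⟩ := c.exists_top
    exact ⟨t, fun x => c.le_iff.2 ⟨c.le_fst x, c.le_snd x⟩⟩

end Poset

section Lattice

variable {L : Type*} [Lattice L] {f g : L → ℕ} {M N : ℕ} {x : L}

theorem fst_inf (c : IsGridCoordinates f g M N) (x y : L) : f (x ⊓ y) = min (f x) (f y) := by
  obtain ⟨z, hf, hg⟩ := c.exists_inf x y
  have hz : z ≤ x ⊓ y := le_inf (c.le_iff.2 (by omega)) (c.le_iff.2 (by omega))
  exact le_antisymm (le_min (c.fst_mono inf_le_left) (c.fst_mono inf_le_right))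
    (hf ▸ c.fst_mono hz)

theorem snd_inf (c : IsGridCoordinates f g M N) (x y : L) : g (x ⊓ y) = min (g x) (g y) :=
  c.swap.fst_inf x y

theorem le_of_inf_covBy (c : IsGridCoordinates f g M N) {a b z : L} (hab : a ⊓ b ⋖ a)
    (hlt : f (a ⊓ b) < f a) (hbz : b ≤ z) (hf : f b < f z) : a ≤ z := by
  rw [c.fst_inf] at hlt
  by_contra haz
  refine hab.2 (c.lt_iff.2 ?_) (inf_lt_left.2 haz)
  have hg := c.snd_mono hbz
  rw [c.fst_inf, c.fst_inf, c.snd_inf, c.snd_inf]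
  omega

theorem covBy_sup_of_inf_covBy (c : IsGridCoordinates f g M N) {a b : L} (hab : a ⊓ b ⋖ a)
    (hlt : f (a ⊓ b) < f a) : b ⋖ a ⊔ b := by
  refine ⟨right_lt_sup.2 fun hle => hab.lt.ne (inf_eq_left.2 hle), fun z hbz hz => ?_⟩
  have sup_le_of_fst_lt {w : L} (hw : b ≤ w) (hf : f b < f w) : a ⊔ b ≤ w :=
    sup_le (c.le_of_inf_covBy hab hlt hw hf) hw
  have hzf : ¬ f b < f z := fun hf => hz.not_ge (sup_le_of_fst_lt hbz.le hf)
  rw [c.fst_inf] at hlt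
  have ha := c.le_fst a
  rw [c.lt_iff] at hbz
  obtain ⟨w, hfw, hgw, hwz⟩ := c.exists_right (x := b) (z := z) (by omega) (by omega) (by omega)
  have hzw : z ≤ w := hz.le.trans (sup_le_of_fst_lt (c.le_iff.2 ⟨hfw.le, hgw⟩) hfw)
  exact (c.snd_mono hzw).not_gt hwz

theorem isUpperModularLattice (c : IsGridCoordinates f g M N) : IsUpperModularLattice L := by
  refine ⟨fun {a b} hab => ?_⟩
  rcases (c.lt_iff.1 hab.lt).2.2 with hlt | hlt
  · exact c.covBy_sup_of_inf_covBy hab hlt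
  · exact c.swap.covBy_sup_of_inf_covBy hab hlt

theorem sup_eq (c : IsGridCoordinates f g M N) {a b : L} (haf : f a = f x) (hag : g a ≤ g x)
    (hbf : f b ≤ f x) (hbg : g b = g x) : a ⊔ b = x := by
  refine le_antisymm (sup_le (c.le_iff.2 ⟨haf.le, hag⟩) (c.le_iff.2 ⟨hbf, hbg.le⟩))
    (c.le_iff.2 ⟨?_, ?_⟩)
  · exact haf ▸ c.fst_mono le_sup_left
  · exact hbg ▸ c.snd_mono le_sup_right

theorem eq_zero_of_supIrred (c : IsGridCoordinates f g M N) (hx : SupIrred x) :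
    f x = 0 ∨ g x = 0 := by
  obtain ⟨a, haf, hag⟩ := c.exists_fst (f x) (c.le_fst x)
  obtain ⟨b, hbf, hbg⟩ := c.exists_snd (g x) (c.le_snd x)
  rcases hx.2 (c.sup_eq haf (by omega) (by omega) hbg) with rfl | rfl
  exacts [Or.inr hag, Or.inl hbf]

theorem supIrred_of_snd_eq_zero (c : IsGridCoordinates f g M N) (hf : 0 < f x) (hg : g x = 0) :
    SupIrred x := by
  refine ⟨fun hmin => ?_, fun {a b} hab => ?_⟩
  · obtain ⟨o, hof, hog⟩ := c.exists_fst 0 (Nat.zero_le _)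
    have := c.fst_mono (hmin (c.le_iff.2 (by omega) : o ≤ x))
    omega
  · have ha := c.snd_mono (hab ▸ le_sup_left : a ≤ x)
    have hb := c.snd_mono (hab ▸ le_sup_right : b ≤ x)
    rcases c.le_total_of_snd_eq (x := a) (y := b) (by omega) with hle | hle
    · exact Or.inr (by rwa [sup_eq_right.2 hle] at hab)
    · exact Or.inl (by rwa [sup_eq_left.2 hle] at hab)

theorem infIrred_of_fst_eq (c : IsGridCoordinates f g M N) (hf : f x = M) (hg : g x < N) :
    InfIrred x := by
  refine ⟨fun hmax => ?_, fun {a b} hab => ?_⟩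
  · obtain ⟨t, htf, htg⟩ := c.exists_top
    have := c.snd_mono (hmax (c.le_iff.2 (by omega) : x ≤ t))
    omega
  · have ha := c.fst_mono (hab ▸ inf_le_left : x ≤ a)
    have hb := c.fst_mono (hab ▸ inf_le_right : x ≤ b)
    have ha' := c.le_fst a
    have hb' := c.le_fst b
    rcases c.swap.le_total_of_snd_eq (x := a) (y := b) (by omega) with hle | hle
    · exact Or.inl (by rwa [inf_eq_left.2 hle] at hab)
    · exact Or.inr (by rwa [inf_eq_right.2 hle] at hab)

theorem fst_eq_of_infIrred (c : IsGridCoordinates f g M N) (hx : InfIrred x) (hg : g x = 0) :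
    f x = M := by
  by_contra hne
  have hlt : f x < M := lt_of_le_of_ne (c.le_fst x) hne
  obtain ⟨a, haf, hag⟩ := c.exists_fst (f x + 1) hlt
  obtain ⟨b, hbg, hxb, hba⟩ :=
    c.exists_above (x := x) (z := a) (by omega) (by omega) (hg ▸ c.pos_snd)
  have hab : a ⊓ b = x := c.ext (by rw [c.fst_inf]; omega) (by rw [c.snd_inf]; omega)
  rcases hx.2 hab with rfl | rfl <;> omega

theorem isSlimRectangular (c : IsGridCoordinates f g M N) : IsSlimRectangular L where
  finite := c.finite
  slim := by
    refine ⟨{x | SupIrred x ∧ g x = 0}, {x | SupIrred x ∧ f x = 0},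
      fun x hx y hy _ => c.le_total_of_snd_eq (hx.2.trans hy.2.symm),
      fun x hx y hy _ => c.swap.le_total_of_snd_eq (hx.2.trans hy.2.symm), ?_⟩
    ext x
    have := c.eq_zero_of_supIrred (x := x)
    simp only [Set.mem_ofPred_eq, Set.mem_union]
    tauto
  semimodular := c.isUpperModularLattice
  corners := by
    have hM := c.pos_fst
    have hN := c.pos_snd
    obtain ⟨u, huf, hug⟩ := c.exists_fst M le_rfl
    obtain ⟨v, hvf, hvg⟩ := c.exists_snd N le_rfl
    refine ⟨u, v, by rintro rfl; omega, Set.ext fun x => ⟨?_, ?_⟩, fun x => c.le_iff.2 ?_,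
      fun x => c.le_iff.2 ⟨?_, ?_⟩⟩
    · rintro ⟨hsup, hinf⟩
      rcases c.eq_zero_of_supIrred hsup with hx | hx
      · have hxN := c.swap.fst_eq_of_infIrred hinf hx
        exact Or.inr (c.ext (hx.trans hvf.symm) (hxN.trans hvg.symm))
      · have hxM := c.fst_eq_of_infIrred hinf hx
        exact Or.inl (c.ext (hxM.trans huf.symm) (hx.trans hug.symm))
    · rintro (rfl | rfl)
      · exact ⟨c.supIrred_of_snd_eq_zero (by omega) hug, c.infIrred_of_fst_eq huf (by omega)⟩
      · exact ⟨c.swap.supIrred_of_snd_eq_zero (by omega) hvf,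
          c.swap.infIrred_of_fst_eq hvg (by omega)⟩
    · rw [c.fst_inf, c.snd_inf]
      omega
    · exact (c.le_fst x).trans (huf ▸ c.fst_mono le_sup_left)
    · exact (c.le_snd x).trans (hvg ▸ c.snd_mono le_sup_right)

end Lattice

variable {P : Type*} [PartialOrder P] {f g : P → ℕ} {M N : ℕ}

theorem exists_lattice_isSlimRectangular (c : IsGridCoordinates f g M N) :
    ∃ inst : Lattice P, inst.toSemilatticeSup.toPartialOrder = ‹PartialOrder P› ∧
      @IsSlimRectangular P inst := by
  obtain ⟨inst, rfl⟩ := c.exists_lattice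
  exact ⟨inst, rfl, c.isSlimRectangular⟩

theorem krullDim_eq (c : IsGridCoordinates f g M N) {x : P} (hx : g x = 0) :
    Order.krullDim P = (Order.coheight x + f x : ℕ∞) := by
  obtain ⟨inst, rfl⟩ := c.exists_lattice
  have := c.isUpperModularLattice
  have := c.finite
  induction hi : f x generalizing x with
  | zero =>
    let _ : OrderBot P := { bot := x, bot_le := fun y => c.le_iff.2 (by omega) }
    rw [Nat.cast_zero, add_zero]
    exact Order.coheight_bot_eq_krullDim.symm
  | succ i ih =>
    obtain ⟨y, hyf, hyg⟩ := c.exists_fst i (by have := c.le_fst x; omega)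
    have hyx : y ⋖ x := c.covBy_of_fst_add_one_eq (by omega) (by omega)
    rw [ih hyg hyf, coheight_eq_add_one_of_covBy hyx]
    push_cast
    ring

end IsGridCoordinates

/-! ### Join-coordinates -/

/-- The join-coordinate of `x` with respect to a chain `C` of join-irreducible elements: the number
of elements of `C` below `x`. -/
noncomputable def joinCoord {P : Type*} [Preorder P] (C : Set P) (x : P) : ℕ :=
  (C ∩ Set.Iic x).ncard

section JoinCoord

variable {P : Type*} {C : Set P}

theorem joinCoord_le_ncard [Preorder P] (hfin : C.Finite) (x : P) : joinCoord C x ≤ C.ncard :=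
  Set.ncard_le_ncard Set.inter_subset_left hfin

theorem joinCoord_eq_ncard [Preorder P] {x : P} (hx : x ∈ upperBounds C) :
    joinCoord C x = C.ncard := by
  have hsub : C ⊆ Set.Iic x := hx
  rw [joinCoord, Set.inter_eq_left.2 hsub]

theorem joinCoord_eq_zero_iff [Preorder P] (hfin : C.Finite) {x : P} :
    joinCoord C x = 0 ↔ ∀ c ∈ C, ¬ c ≤ x := by
  rw [joinCoord, Set.ncard_eq_zero (hfin.inter_of_left _), Set.eq_empty_iff_forall_notMem]
  simp only [Set.mem_inter_iff, Set.mem_Iic, not_and]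

theorem joinCoord_le_iff [Preorder P] (hC : IsChain (· ≤ ·) C) (hfin : C.Finite) {x y : P} :
    joinCoord C x ≤ joinCoord C y ↔ ∀ c ∈ C, c ≤ x → c ≤ y := by
  refine ⟨fun h c hc hcx => ?_, fun h =>
    Set.ncard_le_ncard (fun c hc => ⟨hc.1, h c hc.1 hc.2⟩) (hfin.inter_of_left _)⟩
  by_contra hcy
  refine h.not_gt (Set.ncard_lt_ncard ⟨fun d hd => ⟨hd.1, ?_⟩, fun hsub => hcy (hsub ⟨hc, hcx⟩).2⟩
    (hfin.inter_of_left _))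
  exact ((hC.total hd.1 hc).resolve_right fun hcd => hcy (hcd.trans hd.2)).trans hcx

theorem joinCoord_inf [SemilatticeInf P] (hC : IsChain (· ≤ ·) C) (hfin : C.Finite) (x y : P) :
    joinCoord C (x ⊓ y) = min (joinCoord C x) (joinCoord C y) := by
  refine le_antisymm (le_min ?_ ?_) ?_
  · exact (joinCoord_le_iff hC hfin).2 fun c _ hc => hc.trans inf_le_left
  · exact (joinCoord_le_iff hC hfin).2 fun c _ hc => hc.trans inf_le_right
  · rcases le_total (joinCoord C x) (joinCoord C y) with h | h
    · rw [min_eq_left h, joinCoord_le_iff hC hfin]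
      exact fun c hc hcx => le_inf hcx ((joinCoord_le_iff hC hfin).1 h c hc hcx)
    · rw [min_eq_right h, joinCoord_le_iff hC hfin]
      exact fun c hc hcy => le_inf ((joinCoord_le_iff hC hfin).1 h c hc hcy) hcy

theorem image_joinCoord [PartialOrder P] (hC : IsChain (· ≤ ·) C) (hfin : C.Finite) :
    joinCoord C '' C = Set.Icc 1 C.ncard := by
  have hinj : Set.InjOn (joinCoord C) C := fun c hc d hd h =>
    le_antisymm ((joinCoord_le_iff hC hfin).1 h.le c hc le_rfl)
      ((joinCoord_le_iff hC hfin).1 h.ge d hd le_rfl)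
  refine Set.eq_of_subset_of_ncard_le ?_ ?_
  · rintro _ ⟨c, hc, rfl⟩
    exact ⟨Nat.one_le_iff_ne_zero.2 fun h => (joinCoord_eq_zero_iff hfin).1 h c hc le_rfl,
      joinCoord_le_ncard hfin c⟩
  · rw [hinj.ncard_image]
    simp [Set.ncard_eq_toFinset_card']

end JoinCoord

section SupIrredChains

variable {L : Type*} [Lattice L] {C D : Set L} {u v : L}

/-- The join-irreducible elements form two chains `C` and `D`, whose greatest elements `u` and `v`
meet in the bottom: the lower left and lower right boundary of a slim rectangular lattice, without
the bottom. -/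
structure IsLowerBoundary (C D : Set L) (u v : L) : Prop where
  chain_left : IsChain (· ≤ ·) C
  chain_right : IsChain (· ≤ ·) D
  setOf_supIrred : {x : L | SupIrred x} = C ∪ D
  greatest_left : IsGreatest C u
  greatest_right : IsGreatest D v
  isBot_inf : IsBot (u ⊓ v)

theorem IsLowerBoundary.swap (b : IsLowerBoundary C D u v) : IsLowerBoundary D C v u where
  chain_left := b.chain_right
  chain_right := b.chain_left
  setOf_supIrred := b.setOf_supIrred.trans (Set.union_comm C D)
  greatest_left := b.greatest_right
  greatest_right := b.greatest_left
  isBot_inf := inf_comm u v ▸ b.isBot_inf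

variable [Finite L]

theorem le_iff_joinCoord_le (hC : IsChain (· ≤ ·) C) (hD : IsChain (· ≤ ·) D)
    (hCD : {x : L | SupIrred x} = C ∪ D) {x y : L} :
    x ≤ y ↔ joinCoord C x ≤ joinCoord C y ∧ joinCoord D x ≤ joinCoord D y := by
  have := Fintype.ofFinite L
  have : Nonempty L := ⟨x⟩
  let _ := Fintype.toOrderBot L
  rw [joinCoord_le_iff hC C.toFinite, joinCoord_le_iff hD D.toFinite]
  refine ⟨fun hxy => ⟨fun _ _ hc => hc.trans hxy, fun _ _ hc => hc.trans hxy⟩, fun h =>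
    le_of_forall_supIrred_le fun c hc hcx => ?_⟩
  exact (hCD.subset hc).elim (fun hcC => h.1 c hcC hcx) fun hcD => h.2 c hcD hcx

theorem infIrred_of_mem_upperBounds (hC : IsChain (· ≤ ·) C) (hD : IsChain (· ≤ ·) D)
    (hCD : {x : L | SupIrred x} = C ∪ D) {p : L} (hp : p ∈ upperBounds C) (hmax : ¬ IsMax p) :
    InfIrred p := by
  refine ⟨hmax, fun {a b} hab => ?_⟩
  have joinCoord_eq {x : L} (hx : p ≤ x) : joinCoord C x = C.ncard :=
    joinCoord_eq_ncard fun _ hc => (hp hc).trans hx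
  have hle {x y : L} (hx : p ≤ x) (hy : p ≤ y) (h : joinCoord D x ≤ joinCoord D y) : x ≤ y :=
    (le_iff_joinCoord_le hC hD hCD).2 ⟨((joinCoord_eq hx).trans (joinCoord_eq hy).symm).le, h⟩
  have ha : p ≤ a := hab ▸ inf_le_left
  have hb : p ≤ b := hab ▸ inf_le_right
  rcases le_total (joinCoord D a) (joinCoord D b) with h | h
  · exact Or.inl (by rwa [inf_eq_left.2 (hle ha hb h)] at hab)
  · exact Or.inr (by rwa [inf_eq_right.2 (hle hb ha h)] at hab)

theorem isGreatest_of_corner (hC : IsChain (· ≤ ·) C) (hD : IsChain (· ≤ ·) D)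
    (hCD : {x : L | SupIrred x} = C ∪ D)
    (hcorner : {x : L | SupIrred x ∧ InfIrred x} = {u, v})
    (hbot : IsBot (u ⊓ v)) (htop : IsTop (u ⊔ v)) (hu : u ∈ C) : IsGreatest C u := by
  obtain ⟨p, hp⟩ := C.toFinite.exists_maximal ⟨u, hu⟩
  have hpC : p ∈ upperBounds C := fun c hc => (hC.total hc hp.prop).elim id (hp.le_of_ge hc)
  have hp_irred : SupIrred p := hCD.superset (Or.inl hp.prop)
  obtain ⟨hu_sup, hu_inf⟩ : SupIrred u ∧ InfIrred u := hcorner.superset (Or.inl rfl)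
  have hv_inf : InfIrred v := (hcorner.superset (Or.inr rfl)).2
  have hp_max : ¬ IsMax p := fun hmax => by
    rcases hp_irred.2 (hmax.eq_of_le (htop p)).symm with rfl | rfl
    exacts [hu_inf.1 hmax, hv_inf.1 hmax]
  rcases hcorner.subset ⟨hp_irred, infIrred_of_mem_upperBounds hC hD hCD hpC hp_max⟩ with rfl | rfl
  · exact ⟨hu, hpC⟩
  · exact absurd (inf_eq_left.2 (hpC hu) ▸ hbot).isMin hu_sup.1

namespace IsLowerBoundary

theorem le_iff (b : IsLowerBoundary C D u v) {x y : L} :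
    x ≤ y ↔ joinCoord C x ≤ joinCoord C y ∧ joinCoord D x ≤ joinCoord D y :=
  le_iff_joinCoord_le b.chain_left b.chain_right b.setOf_supIrred

theorem pos_fst (b : IsLowerBoundary C D u v) : 0 < C.ncard :=
  (Set.ncard_pos C.toFinite).2 ⟨u, b.greatest_left.1⟩

theorem joinCoord_eq_zero_of_le (b : IsLowerBoundary C D u v) {x : L} (hx : x ≤ u) :
    joinCoord D x = 0 :=
  (joinCoord_eq_zero_iff D.toFinite).2 fun d hd hdx => by
    have hd_irred : SupIrred d := b.setOf_supIrred.superset (Or.inr hd)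
    have hd_le : d ≤ u ⊓ v := le_inf (hdx.trans hx) (b.greatest_right.2 hd)
    exact hd_irred.1 fun y _ => hd_le.trans (b.isBot_inf y)

theorem exists_joinCoord_eq (b : IsLowerBoundary C D u v) {i : ℕ} (hi : i ≤ C.ncard) :
    ∃ x, joinCoord C x = i ∧ joinCoord D x = 0 := by
  rcases Nat.eq_zero_or_pos i with rfl | hpos
  · exact ⟨u ⊓ v, b.swap.joinCoord_eq_zero_of_le inf_le_right,
      b.joinCoord_eq_zero_of_le inf_le_left⟩
  · obtain ⟨c, hc, hci⟩ := (image_joinCoord b.chain_left C.toFinite).superset ⟨hpos, hi⟩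
    exact ⟨c, hci, b.joinCoord_eq_zero_of_le (b.greatest_left.2 hc)⟩

theorem exists_right [IsUpperModularLattice L] (b : IsLowerBoundary C D u v) {x z : L}
    (hxz : joinCoord C x = joinCoord C z) (hlt : joinCoord D x < joinCoord D z)
    (hx : joinCoord C x < C.ncard) :
    ∃ w, joinCoord C x < joinCoord C w ∧ joinCoord D x ≤ joinCoord D w ∧
      joinCoord D w < joinCoord D z := by
  obtain ⟨c, hcC, hcD⟩ := b.exists_joinCoord_eq hx
  have fst_inf := joinCoord_inf b.chain_left C.toFinite x c
  have hxc : x ⊓ c ⋖ c := by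
    refine ⟨inf_lt_right.2 fun hcx => ?_, fun y hy hyc => ?_⟩
    · have := b.le_iff.1 hcx
      omega
    · rw [lt_iff_le_not_ge, b.le_iff, b.le_iff] at hy hyc
      omega
  have hcov : x ⋖ x ⊔ c := covBy_sup_of_inf_covBy_right hxc
  have hxw := b.le_iff.1 hcov.le
  have hcw := b.le_iff.1 (le_sup_right : c ≤ x ⊔ c)
  refine ⟨x ⊔ c, by omega, hxw.2, not_le.1 fun hzw => hcov.2 (c := z) ?_ ?_⟩ <;>
  · rw [lt_iff_le_not_ge, b.le_iff, b.le_iff]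
    omega

theorem isGridCoordinates [IsUpperModularLattice L] (b : IsLowerBoundary C D u v) :
    IsGridCoordinates (joinCoord C) (joinCoord D) C.ncard D.ncard where
  pos_fst := b.pos_fst
  pos_snd := b.swap.pos_fst
  le_iff := b.le_iff
  exists_inf x y := ⟨x ⊓ y, joinCoord_inf b.chain_left C.toFinite x y,
    joinCoord_inf b.chain_right D.toFinite x y⟩
  exists_top := ⟨u ⊔ v, joinCoord_eq_ncard fun _ hc => le_sup_of_le_left (b.greatest_left.2 hc),
    joinCoord_eq_ncard fun _ hd => le_sup_of_le_right (b.greatest_right.2 hd)⟩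
  le_fst := joinCoord_le_ncard C.toFinite
  le_snd := joinCoord_le_ncard D.toFinite
  exists_fst _ hi := b.exists_joinCoord_eq hi
  exists_snd _ hj := (b.swap.exists_joinCoord_eq hj).imp fun _ => And.symm
  exists_right := b.exists_right
  exists_above := b.swap.exists_right

end IsLowerBoundary

end SupIrredChains

namespace IsSlimRectangular

variable {L : Type*} [Lattice L]

theorem exists_isLowerBoundary (hL : IsSlimRectangular L) :
    ∃ (C D : Set L) (u v : L), IsLowerBoundary C D u v := by
  obtain ⟨_, ⟨C, D, hC, hD, hCD⟩, -, u, v, -, hcorner, hbot, htop⟩ := hL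
  have hu : SupIrred u := (hcorner.superset (Or.inl rfl)).1
  have hv : SupIrred v := (hcorner.superset (Or.inr rfl)).1
  have not_comparable {E : Set L} (hE : IsChain (· ≤ ·) E) (huE : u ∈ E) : v ∉ E := fun hvE => by
    rcases hE.total huE hvE with h | h
    · exact hu.1 (inf_eq_left.2 h ▸ hbot).isMin
    · exact hv.1 (inf_eq_right.2 h ▸ hbot).isMin
  wlog huC : u ∈ C generalizing C D
  · exact this D C hD hC (hCD.trans (Set.union_comm C D)) ((hCD.subset hu).resolve_left huC)
  have hvD : v ∈ D := (hCD.subset hv).resolve_left (not_comparable hC huC)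
  refine ⟨C, D, u, v, hC, hD, hCD, isGreatest_of_corner hC hD hCD hcorner hbot htop huC, ?_, hbot⟩
  exact isGreatest_of_corner hD hC (hCD.trans (Set.union_comm C D))
    (hcorner.trans (Set.pair_comm u v)) (inf_comm u v ▸ hbot) (sup_comm u v ▸ htop) hvD

theorem exists_isGridCoordinates (hL : IsSlimRectangular L) :
    ∃ (f g : L → ℕ) (M N : ℕ), IsGridCoordinates f g M N := by
  have := hL.finite
  have := hL.semimodular
  obtain ⟨C, D, u, v, hCD⟩ := hL.exists_isLowerBoundary
  exact ⟨_, _, _, _, hCD.isGridCoordinates⟩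

end IsSlimRectangular

/-! ### Trajectories in a full rectangle -/

/-- Every grid point of the rectangle spanned by the origin and by the point `t` is occupied. -/
def IsFullBelow {P : Type*} (f g : P → ℕ) (t : P) : Prop :=
  ∀ i ≤ f t, ∀ j ≤ g t, ∃ x, f x = i ∧ g x = j

namespace IsFullBelow

section Poset

variable {P : Type*} {f g : P → ℕ} {M N : ℕ} {t : P}

theorem swap (full : IsFullBelow f g t) : IsFullBelow g f t := fun j hj i hi =>
  (full i hi j hj).imp fun _ => And.symm

theorem mono (full : IsFullBelow f g t) {x : P} (hf : f x ≤ f t) (hg : g x ≤ g t) :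
    IsFullBelow f g x := fun i hi j hj => full i (hi.trans hf) j (hj.trans hg)

theorem height_eq [PartialOrder P] (full : IsFullBelow f g t) (c : IsGridCoordinates f g M N) :
    Order.height t = (f t + g t : ℕ) := by
  refine height_eq_of_exists_add_one_eq c.strictMono_add fun x hx hpos => ?_
  obtain ⟨hf, hg⟩ := c.le_iff.1 hx
  simp only [Pi.add_apply] at hpos ⊢
  rcases Nat.eq_zero_or_pos (f x) with hfx | hfx
  · obtain ⟨y, hyf, hyg⟩ := full (f x) hf (g x - 1) (by omega)
    exact ⟨y, c.lt_iff.2 (by omega), by omega⟩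
  · obtain ⟨y, hyf, hyg⟩ := full (f x - 1) (by omega) (g x) hg
    exact ⟨y, c.lt_iff.2 (by omega), by omega⟩

theorem fst_add_one_eq_of_covBy [PartialOrder P] (full : IsFullBelow f g t)
    (c : IsGridCoordinates f g M N) {x : P} (hx : x ⋖ t) (hlt : f x < f t) :
    f x + 1 = f t ∧ g x = g t := by
  have hxt := c.le_iff.1 hx.le
  obtain ⟨y, hyf, hyg⟩ := full (f x + 1) hlt (g x) hxt.2
  have hy : y = t :=
    (hx.eq_or_eq (c.le_iff.2 (by omega)) (c.le_iff.2 (by omega))).resolve_left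
      (by rintro rfl; omega)
  subst hy
  exact ⟨hyf.symm, hyg.symm⟩

theorem eq_or_eq_of_covBy [PartialOrder P] (full : IsFullBelow f g t)
    (c : IsGridCoordinates f g M N) {x : P} (hx : x ⋖ t) :
    (f x + 1 = f t ∧ g x = g t) ∨ (f x = f t ∧ g x + 1 = g t) := by
  rcases (c.lt_iff.1 hx.lt).2.2 with hlt | hlt
  · exact Or.inl (full.fst_add_one_eq_of_covBy c hx hlt)
  · exact Or.inr (full.swap.fst_add_one_eq_of_covBy c.swap hx hlt).symm

end Poset

end IsFullBelow

namespace IsGridCoordinates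

variable {L : Type*} [Lattice L] {f g : L → ℕ} {M N : ℕ} {t : L}

theorem fst_sup_eq_of_distrib (c : IsGridCoordinates f g M N)
    (distrib : ∀ x y z : L, x ≤ t → y ≤ t → z ≤ t → x ⊓ (y ⊔ z) = (x ⊓ y) ⊔ (x ⊓ z))
    {a b : L} (ha : a ≤ t) (hb : b ≤ t) (hga : g a = 0) (hfb : f b = 0) : f (a ⊔ b) = f a := by
  have hab := c.fst_mono (le_sup_left : a ≤ a ⊔ b)
  obtain ⟨e, hef, heg⟩ := c.exists_fst (f (a ⊔ b)) (c.le_fst _)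
  have he : e ≤ a ⊔ b := c.le_iff.2 (by omega)
  have hea : e ≤ a := by
    rw [← inf_eq_left.2 he, distrib e a b (he.trans (sup_le ha hb)) ha hb]
    exact sup_le inf_le_right (c.le_iff.2 (by rw [c.fst_inf, c.snd_inf]; omega))
  have := c.fst_mono hea
  omega

theorem isFullBelow_of_distrib (c : IsGridCoordinates f g M N)
    (distrib : ∀ x y z : L, x ≤ t → y ≤ t → z ≤ t → x ⊓ (y ⊔ z) = (x ⊓ y) ⊔ (x ⊓ z)) :
    IsFullBelow f g t := fun i hi j hj => by
  obtain ⟨a, haf, hag⟩ := c.exists_fst i (hi.trans (c.le_fst t))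
  obtain ⟨b, hbf, hbg⟩ := c.exists_snd j (hj.trans (c.le_snd t))
  have ha : a ≤ t := c.le_iff.2 (by omega)
  have hb : b ≤ t := c.le_iff.2 (by omega)
  refine ⟨a ⊔ b, (c.fst_sup_eq_of_distrib distrib ha hb hag hbf).trans haf, ?_⟩
  rw [sup_comm]
  exact (c.swap.fst_sup_eq_of_distrib distrib hb ha hbf hag).trans hbg

end IsGridCoordinates

/-- The edge `e` joins the columns `p - 1` and `p` of the grid in row `j`. -/
structure IsRowEdge {P : Type*} (f g : P → ℕ) (p j : ℕ) (e : P × P) : Prop where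
  fst_lower : f e.1 + 1 = p
  fst_upper : f e.2 = p
  snd_lower : g e.1 = j
  snd_upper : g e.2 = j

theorem IsRowEdge.eq {P : Type*} [PartialOrder P] {f g : P → ℕ} {M N p j : ℕ} {e e' : P × P}
    (he : IsRowEdge f g p j e) (he' : IsRowEdge f g p j e') (c : IsGridCoordinates f g M N) :
    e = e' := by
  obtain ⟨h₁, h₂, h₃, h₄⟩ := he
  obtain ⟨h₁', h₂', h₃', h₄'⟩ := he'
  exact Prod.ext (c.ext (by omega) (by omega)) (c.ext (by omega) (by omega))

theorem IsFullBelow.exists_isRowEdge {P : Type*} {f g : P → ℕ} {t : P} (full : IsFullBelow f g t)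
    (hpos : 0 < f t) {j : ℕ} (hj : j ≤ g t) : ∃ e, IsRowEdge f g (f t) j e := by
  obtain ⟨x, hxf, hxg⟩ := full (f t - 1) (Nat.sub_le _ _) j hj
  obtain ⟨y, hyf, hyg⟩ := full (f t) le_rfl j hj
  exact ⟨(x, y), by dsimp only; omega, hyf, hxg, hyg⟩

namespace FourCell

section Coordinates

variable {L : Type*} [Lattice L] {H : FourCell L} {f g : L → ℕ} {M N p j : ℕ}

/-- The mirror image of a 4-cell. -/
def flip (H : FourCell L) : FourCell L where
  bot := H.bot
  left := H.right
  right := H.left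
  top := H.top
  left_inf_right := inf_comm H.right H.left ▸ H.left_inf_right
  left_sup_right := sup_comm H.right H.left ▸ H.left_sup_right
  bot_covBy_left := H.bot_covBy_right
  bot_covBy_right := H.bot_covBy_left
  left_covBy_top := H.right_covBy_top
  right_covBy_top := H.left_covBy_top

theorem left_ne_right (T : FourCell L) : T.left ≠ T.right := fun h =>
  T.bot_covBy_left.ne (by rw [← T.left_inf_right, ← h, inf_idem])

/-- The 4-cell `T` is a unit square of the grid, the edge from `T.bot` to `T.left` pointing in the
direction of the first coordinate. -/
structure IsUnitSquare (T : FourCell L) (f g : L → ℕ) : Prop where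
  fst_bot : f T.bot + 1 = f T.top
  snd_bot : g T.bot + 1 = g T.top
  fst_left : f T.left = f T.top
  snd_left : g T.left + 1 = g T.top
  fst_right : f T.right + 1 = f T.top
  snd_right : g T.right = g T.top

theorem IsUnitSquare.flip {T : FourCell L} (hT : T.IsUnitSquare f g) :
    T.flip.IsUnitSquare g f where
  fst_bot := hT.snd_bot
  snd_bot := hT.fst_bot
  fst_left := hT.snd_right
  snd_left := hT.fst_right
  fst_right := hT.snd_left
  snd_right := hT.fst_left

theorem isUnitSquare_or (T : FourCell L) (c : IsGridCoordinates f g M N)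
    (full : IsFullBelow f g T.top) : T.IsUnitSquare f g ∨ T.IsUnitSquare g f := by
  have hl := full.eq_or_eq_of_covBy c T.left_covBy_top
  have hr := full.eq_or_eq_of_covBy c T.right_covBy_top
  have hne : ¬(f T.left = f T.right ∧ g T.left = g T.right) := fun h =>
    T.left_ne_right (c.ext h.1 h.2)
  have hf := c.fst_inf T.left T.right
  have hg := c.snd_inf T.left T.right
  rw [T.left_inf_right] at hf hg
  rcases hl with hl | hl
  · exact Or.inr (by constructor <;> omega)
  · exact Or.inl (by constructor <;> omega)

theorem stepDown_of_isRowEdge (c : IsGridCoordinates f g M N) {e e' : L × L}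
    (he : IsRowEdge f g p (j + 1) e) (he' : IsRowEdge f g p j e') : StepDown e e' := by
  obtain ⟨h₁, h₂, h₃, h₄⟩ := he
  obtain ⟨h₁', h₂', h₃', h₄'⟩ := he'
  refine ⟨{
    bot := e'.1, left := e.1, right := e'.2, top := e.2
    left_inf_right := c.ext (by rw [c.fst_inf]; omega) (by rw [c.snd_inf]; omega)
    left_sup_right := ?_
    bot_covBy_left := c.swap.covBy_of_fst_add_one_eq (by omega) (by omega)
    bot_covBy_right := c.covBy_of_fst_add_one_eq (by omega) (by omega)
    left_covBy_top := c.covBy_of_fst_add_one_eq (by omega) (by omega)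
    right_covBy_top := c.swap.covBy_of_fst_add_one_eq (by omega) (by omega) }, rfl, rfl⟩
  rw [sup_comm]
  exact c.sup_eq (by omega) (by omega) (by omega) (by omega)

theorem reflTransGen_stepDown_of_isRowEdge (c : IsGridCoordinates f g M N) {t : L}
    (full : IsFullBelow f g t) (hpos : 0 < f t) (hj : j ≤ g t) {i : ℕ} (hij : i ≤ j) {e e' : L × L}
    (he : IsRowEdge f g (f t) j e) (he' : IsRowEdge f g (f t) i e') :
    Relation.ReflTransGen StepDown e e' := by
  induction hij using Nat.decreasingInduction generalizing e' with
  | self => rw [he.eq he' c]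
  | of_succ i hij ih =>
    obtain ⟨d, hd⟩ := full.exists_isRowEdge hpos (Nat.le_trans hij hj)
    exact (ih hd).tail (stepDown_of_isRowEdge c hd he')

theorem exists_isRowEdge_of_stepDown (c : IsGridCoordinates f g M N) {t : L}
    (full : IsFullBelow f g t) {e e' : L × L} (hp : p ≤ f t) (hj : j ≤ g t)
    (he : IsRowEdge f g p j e) (hstep : StepDown e e') :
    ∃ i < j, IsRowEdge f g p i e' := by
  obtain ⟨T, rfl, rfl⟩ := hstep
  obtain ⟨h₁, h₂, h₃, h₄⟩ := he
  dsimp only at h₁ h₂ h₃ h₄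
  rcases T.isUnitSquare_or c (full.mono (by omega) (by omega)) with hT | hT
  · have := hT.fst_left
    omega
  · have := hT.fst_bot
    have := hT.snd_bot
    have := hT.snd_left
    have := hT.fst_right
    have := hT.snd_right
    exact ⟨g T.bot, by omega, by dsimp only; omega, by dsimp only; omega, rfl,
      by dsimp only; omega⟩

/-- `H` is the top unit square of a full rectangle in a lattice with grid coordinates. -/
structure IsGridCell (H : FourCell L) (f g : L → ℕ) (M N : ℕ) : Prop
    extends IsGridCoordinates f g M N where
  isUnitSquare : H.IsUnitSquare f g
  isFullBelow : IsFullBelow f g H.top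

theorem exists_isGridCell (hL : IsSlimRectangular L) (hH : H.IsDistributive) :
    ∃ (f g : L → ℕ) (M N : ℕ), H.IsGridCell f g M N := by
  obtain ⟨f, g, M, N, c⟩ := hL.exists_isGridCoordinates
  have full : IsFullBelow f g H.top := c.isFullBelow_of_distrib hH
  rcases H.isUnitSquare_or c full with hsq | hsq
  · exact ⟨f, g, M, N, c, hsq, full⟩
  · exact ⟨g, f, N, M, c.swap, hsq, full.swap⟩

namespace IsGridCell

theorem flip (c : H.IsGridCell f g M N) : H.flip.IsGridCell g f N M :=
  ⟨c.swap, c.isUnitSquare.flip, c.isFullBelow.swap⟩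

theorem fst_top_pos (c : H.IsGridCell f g M N) : 0 < f H.top := by
  have := c.isUnitSquare.fst_bot
  omega

theorem isRowEdge_bot_left (c : H.IsGridCell f g M N) :
    IsRowEdge f g (f H.top) (g H.bot) (H.bot, H.left) :=
  ⟨c.isUnitSquare.fst_bot, c.isUnitSquare.fst_left, rfl,
    Nat.succ_injective (c.isUnitSquare.snd_left.trans c.isUnitSquare.snd_bot.symm)⟩

theorem exists_isRowEdge_of_mem_leftEdges (c : H.IsGridCell f g M N) {e : L × L}
    (he : e ∈ H.leftEdges) : ∃ j < g H.top, IsRowEdge f g (f H.top) j e := by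
  change Relation.ReflTransGen StepDown (H.bot, H.left) e at he
  induction he with
  | refl => exact ⟨g H.bot, c.isUnitSquare.snd_bot.le, c.isRowEdge_bot_left⟩
  | tail _ hstep ih =>
    obtain ⟨j, hj, he⟩ := ih
    obtain ⟨i, hij, hi⟩ :=
      exists_isRowEdge_of_stepDown c.toIsGridCoordinates c.isFullBelow le_rfl hj.le he hstep
    exact ⟨i, hij.trans hj, hi⟩

theorem exists_isRowEdge_of_mem_rightEdges (c : H.IsGridCell f g M N) {e : L × L}
    (he : e ∈ H.rightEdges) : ∃ j < f H.top, IsRowEdge g f (g H.top) j e :=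
  c.flip.exists_isRowEdge_of_mem_leftEdges he

theorem mem_leftEdges_of_isRowEdge (c : H.IsGridCell f g M N) (hj : j < g H.top) {e : L × L}
    (he : IsRowEdge f g (f H.top) j e) : e ∈ H.leftEdges := by
  have hbot := c.isUnitSquare.snd_bot
  exact reflTransGen_stepDown_of_isRowEdge c.toIsGridCoordinates c.isFullBelow c.fst_top_pos
    (by omega) (by omega) c.isRowEdge_bot_left he

theorem mem_rightEdges_of_isRowEdge (c : H.IsGridCell f g M N) (hj : j < f H.top) {e : L × L}
    (he : IsRowEdge g f (g H.top) j e) : e ∈ H.rightEdges :=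
  c.flip.mem_leftEdges_of_isRowEdge hj he

theorem reflTransGen_of_mem_leftEdges (c : H.IsGridCell f g M N) {e e' : L × L}
    (he : e ∈ H.leftEdges) (he' : e' ∈ H.leftEdges) (h : g e'.2 ≤ g e.2) :
    Relation.ReflTransGen StepDown e e' := by
  obtain ⟨j, hj, hrow⟩ := c.exists_isRowEdge_of_mem_leftEdges he
  obtain ⟨j', -, hrow'⟩ := c.exists_isRowEdge_of_mem_leftEdges he'
  exact reflTransGen_stepDown_of_isRowEdge c.toIsGridCoordinates c.isFullBelow c.fst_top_pos hj.le
    (by rwa [← hrow.snd_upper, ← hrow'.snd_upper]) hrow hrow'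

theorem reflTransGen_of_mem_rightEdges (c : H.IsGridCell f g M N) {e e' : L × L}
    (he : e ∈ H.rightEdges) (he' : e' ∈ H.rightEdges) (h : f e'.2 ≤ f e.2) :
    Relation.ReflTransGen StepDown e e' :=
  c.flip.reflTransGen_of_mem_leftEdges he he' h

theorem ncard_leftEdges (c : H.IsGridCell f g M N) : H.leftEdges.ncard = g H.top := by
  have hinj : Set.InjOn (fun e => g e.2) H.leftEdges := fun e he e' he' h => by
    obtain ⟨j, -, hj⟩ := c.exists_isRowEdge_of_mem_leftEdges he
    obtain ⟨j', -, hj'⟩ := c.exists_isRowEdge_of_mem_leftEdges he'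
    obtain rfl : j = j' := hj.snd_upper.symm.trans (h.trans hj'.snd_upper)
    exact hj.eq hj' c.toIsGridCoordinates
  have himage : (fun e => g e.2) '' H.leftEdges = Set.Iio (g H.top) := by
    refine Set.Subset.antisymm ?_ fun j hj => ?_
    · rintro _ ⟨e, he, rfl⟩
      obtain ⟨j, hj, hrow⟩ := c.exists_isRowEdge_of_mem_leftEdges he
      exact hrow.snd_upper.trans_lt hj
    · obtain ⟨e, he⟩ := c.isFullBelow.exists_isRowEdge c.fst_top_pos (le_of_lt hj)
      exact ⟨e, c.mem_leftEdges_of_isRowEdge hj he, he.snd_upper⟩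
  rw [← hinj.ncard_image, himage]
  simp [Set.ncard_eq_toFinset_card']

theorem ncard_rightEdges (c : H.IsGridCell f g M N) : H.rightEdges.ncard = f H.top :=
  c.flip.ncard_leftEdges

end IsGridCell

end Coordinates

end FourCell

/-! ### Coordinates on the multifork extension -/

/-- The position of the `i`-th column of the grid after `k` new columns have been inserted before
the `m`-th one. -/
def gridShift (m k i : ℕ) : ℕ := if i < m then i else i + k

theorem gridShift_of_lt {m k i : ℕ} (h : i < m) : gridShift m k i = i := if_pos h

theorem gridShift_of_le {m k i : ℕ} (h : m ≤ i) : gridShift m k i = i + k := if_neg h.not_gt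

theorem gridShift_strictMono (m k : ℕ) : StrictMono (gridShift m k) := fun i j h => by
  simp only [gridShift]
  split_ifs <;> omega

namespace FourCell

namespace MultiforkExtension

section Order

variable {L : Type*} [Lattice L] {H : FourCell L} {k : ℕ}

theorem bot_left_mem : (H.bot, H.left) ∈ H.leftEdges := Relation.ReflTransGen.refl

theorem bot_right_mem : (H.bot, H.right) ∈ H.rightEdges := Relation.ReflTransGen.refl

theorem Step.le {a b : MultiforkExtension H k} (h : Step a b) : a ≤ b :=
  Relation.ReflTransGen.single h

/-- The greatest old element below a given element of the multifork extension. -/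
def floor : MultiforkExtension H k → L
  | old x => x
  | onLeft e _ _ => e.1
  | onRight e _ _ => e.1
  | inner _ _ _ => H.bot

/-- The least old element above a given element of the multifork extension. -/
def ceil : MultiforkExtension H k → L
  | old x => x
  | onLeft e _ _ => e.2
  | onRight e _ _ => e.2
  | inner _ _ _ => H.top

theorem old_le_of_le_floor {x : L} {a : MultiforkExtension H k} (h : x ≤ a.floor) :
    old x ≤ a := by
  refine (Step.old_old x _ h).le.trans ?_
  cases a with
  | old y => exact le_rfl
  | onLeft e he i => exact (Step.old_onLeft e he i).le
  | onRight e he i => exact (Step.old_onRight e he i).le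
  | inner i j hij =>
    exact (Step.old_onLeft _ bot_left_mem j).le.trans (Step.onLeft_inner _ i j hij).le

theorem le_old_of_ceil_le {x : L} {a : MultiforkExtension H k} (h : a.ceil ≤ x) :
    a ≤ old x := by
  refine le_trans ?_ (Step.old_old _ x h).le
  cases a with
  | old y => exact le_rfl
  | onLeft e he i => exact (Step.onLeft_old e he i).le
  | onRight e he i => exact (Step.onRight_old e he i).le
  | inner i j hij => exact (Step.inner_old i j hij).le

theorem onLeft_le_onLeft {e e' : L × L} (he : e ∈ H.leftEdges) (he' : e' ∈ H.leftEdges)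
    (h : Relation.ReflTransGen StepDown e' e) {i i' : Fin k} (hi : i' ≤ i) :
    onLeft e he i ≤ onLeft e' he' i' := by
  refine le_trans ?_ (Step.onLeft_chain e' he' i i' hi).le
  induction h with
  | refl => exact le_rfl
  | @tail d e hd hstep ih =>
    exact (Step.onLeft_cross d e (he'.trans hd) he hstep i).le.trans (ih _)

theorem onRight_le_onRight {e e' : L × L} (he : e ∈ H.rightEdges) (he' : e' ∈ H.rightEdges)
    (h : Relation.ReflTransGen StepDown e' e) {i i' : Fin k} (hi : i ≤ i') :
    onRight e he i ≤ onRight e' he' i' := by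
  refine le_trans ?_ (Step.onRight_chain e' he' i i' hi).le
  induction h with
  | refl => exact le_rfl
  | @tail d e hd hstep ih =>
    exact (Step.onRight_cross d e (he'.trans hd) he hstep i).le.trans (ih _)

theorem onLeft_le_inner {e : L × L} (he : e ∈ H.leftEdges) {l i j : Fin k} (hij : i ≤ j)
    (hjl : j ≤ l) : onLeft e he l ≤ inner i j hij :=
  (onLeft_le_onLeft he bot_left_mem he hjl).trans (Step.onLeft_inner _ i j hij).le

theorem onRight_le_inner {e : L × L} (he : e ∈ H.rightEdges) {l i j : Fin k} (hij : i ≤ j)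
    (hli : l ≤ i) : onRight e he l ≤ inner i j hij :=
  (onRight_le_onRight he bot_right_mem he hli).trans (Step.onRight_inner _ i j hij).le

end Order

section Coordinates

variable {L : Type*} [Lattice L] {H : FourCell L} {k : ℕ}

/-- The first coordinate on the multifork extension, which inserts `k` new columns into the grid
before the column of `H.top`. -/
def fst (f : L → ℕ) : MultiforkExtension H k → ℕ
  | old x => gridShift (f H.top) k (f x)
  | onLeft _ _ i => f H.top + (k - 1 - i)
  | onRight e _ _ => f e.2
  | inner _ j _ => f H.top + (k - 1 - j)

/-- The second coordinate on the multifork extension, which inserts `k` new rows into the grid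
before the row of `H.top`. -/
def snd (g : L → ℕ) : MultiforkExtension H k → ℕ
  | old x => gridShift (g H.top) k (g x)
  | onLeft e _ _ => g e.2
  | onRight _ _ i => g H.top + i
  | inner i _ _ => g H.top + i

end Coordinates

end MultiforkExtension

namespace IsGridCell

open MultiforkExtension

variable {L : Type*} [Lattice L] {H : FourCell L} {f g : L → ℕ} {M N k : ℕ}
  {a b : MultiforkExtension H k}

theorem coordinates_le_of_step (c : H.IsGridCell f g M N) (h : Step a b) :
    fst f a ≤ fst f b ∧ snd g a ≤ snd g b := by
  cases h with
  | old_old x y hxy =>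
    exact ⟨(gridShift_strictMono _ k).monotone (c.fst_mono hxy),
      (gridShift_strictMono _ k).monotone (c.snd_mono hxy)⟩
  | old_onLeft e he i | onLeft_old e he i | onLeft_chain e he i i' hi =>
    obtain ⟨j, hj, h₁, h₂, h₃, h₄⟩ := c.exists_isRowEdge_of_mem_leftEdges he
    simp only [fst, snd, gridShift]
    try split_ifs
    all_goals omega
  | old_onRight e he i | onRight_old e he i | onRight_chain e he i i' hi =>
    obtain ⟨j, hj, h₁, h₂, h₃, h₄⟩ := c.exists_isRowEdge_of_mem_rightEdges he
    simp only [fst, snd, gridShift]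
    try split_ifs
    all_goals omega
  | onLeft_cross e e' he he' hstep i | onRight_cross e e' he he' hstep i =>
    obtain ⟨T, rfl, rfl⟩ := hstep
    have := c.le_iff.1 T.right_covBy_top.le
    simp only [fst, snd]
    omega
  | onLeft_inner he i j hij | onRight_inner he i j hij =>
    have := c.isUnitSquare.snd_left
    have := c.isUnitSquare.fst_right
    simp only [fst, snd]
    omega
  | inner_inner i j i' j' hij hij' hi hj =>
    simp only [fst, snd]
    omega
  | inner_old i j hij =>
    simp only [fst, snd, gridShift_of_le le_rfl]
    omega

theorem coordinates_le_of_le (c : H.IsGridCell f g M N) (h : a ≤ b) :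
    fst f a ≤ fst f b ∧ snd g a ≤ snd g b := by
  change Relation.ReflTransGen Step a b at h
  induction h with
  | refl => exact ⟨le_rfl, le_rfl⟩
  | tail _ hstep ih =>
    have := c.coordinates_le_of_step hstep
    exact ⟨ih.1.trans this.1, ih.2.trans this.2⟩

theorem old_le_of_coordinates_le (c : H.IsGridCell f g M N) {x : L}
    (hf : gridShift (f H.top) k (f x) ≤ fst f b) (hg : gridShift (g H.top) k (g x) ≤ snd g b) :
    old x ≤ b := by
  refine old_le_of_le_floor (c.le_iff.2 ?_)
  cases b with
  | old y =>
    exact ⟨(gridShift_strictMono _ k).le_iff_le.1 hf, (gridShift_strictMono _ k).le_iff_le.1 hg⟩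
  | onLeft e he i =>
    obtain ⟨j, hj, h₁, h₂, h₃, h₄⟩ := c.exists_isRowEdge_of_mem_leftEdges he
    simp only [fst, snd, gridShift, floor] at hf hg ⊢
    split_ifs at hf hg <;> omega
  | onRight e he i =>
    obtain ⟨j, hj, h₁, h₂, h₃, h₄⟩ := c.exists_isRowEdge_of_mem_rightEdges he
    simp only [fst, snd, gridShift, floor] at hf hg ⊢
    split_ifs at hf hg <;> omega
  | inner i j hij =>
    have := c.isUnitSquare.fst_bot
    have := c.isUnitSquare.snd_bot
    simp only [fst, snd, gridShift, floor] at hf hg ⊢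
    split_ifs at hf hg <;> omega

theorem le_old_of_coordinates_le (c : H.IsGridCell f g M N) {x : L}
    (hf : fst f a ≤ gridShift (f H.top) k (f x)) (hg : snd g a ≤ gridShift (g H.top) k (g x)) :
    a ≤ old x := by
  refine le_old_of_ceil_le (c.le_iff.2 ?_)
  cases a with
  | old y =>
    exact ⟨(gridShift_strictMono _ k).le_iff_le.1 hf, (gridShift_strictMono _ k).le_iff_le.1 hg⟩
  | onLeft e he i =>
    obtain ⟨j, hj, -, h₁, h₂, h₃⟩ := c.exists_isRowEdge_of_mem_leftEdges he
    simp only [fst, snd, gridShift, ceil] at hf hg ⊢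
    split_ifs at hf hg <;> omega
  | onRight e he i =>
    obtain ⟨j, hj, -, h₁, h₂, h₃⟩ := c.exists_isRowEdge_of_mem_rightEdges he
    simp only [fst, snd, gridShift, ceil] at hf hg ⊢
    split_ifs at hf hg <;> omega
  | inner i j hij =>
    simp only [fst, snd, gridShift, ceil] at hf hg ⊢
    split_ifs at hf hg <;> omega

theorem onLeft_le_of_coordinates_le (c : H.IsGridCell f g M N) {e : L × L} (he : e ∈ H.leftEdges)
    (i : Fin k) (hf : f H.top + (k - 1 - i) ≤ fst f b) (hg : g e.2 ≤ snd g b) :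
    onLeft e he i ≤ b := by
  cases b with
  | old y => exact c.le_old_of_coordinates_le hf hg
  | onLeft e' he' i' =>
    simp only [fst] at hf
    exact onLeft_le_onLeft he he' (c.reflTransGen_of_mem_leftEdges he' he hg) (by omega)
  | onRight e' he' i' =>
    obtain ⟨j, hj, -, -, h₁, h₂⟩ := c.exists_isRowEdge_of_mem_rightEdges he'
    simp only [fst] at hf
    omega
  | inner i' j' hij' =>
    simp only [fst] at hf
    exact onLeft_le_inner he hij' (by omega)

theorem onRight_le_of_coordinates_le (c : H.IsGridCell f g M N) {e : L × L}
    (he : e ∈ H.rightEdges) (i : Fin k) (hf : f e.2 ≤ fst f b) (hg : g H.top + i ≤ snd g b) :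
    onRight e he i ≤ b := by
  cases b with
  | old y => exact c.le_old_of_coordinates_le hf hg
  | onLeft e' he' i' =>
    obtain ⟨j, hj, -, -, h₁, h₂⟩ := c.exists_isRowEdge_of_mem_leftEdges he'
    simp only [snd] at hg
    omega
  | onRight e' he' i' =>
    simp only [snd] at hg
    exact onRight_le_onRight he he' (c.reflTransGen_of_mem_rightEdges he' he hf) (by omega)
  | inner i' j' hij' =>
    simp only [snd] at hg
    exact onRight_le_inner he hij' (by omega)

theorem inner_le_of_coordinates_le (c : H.IsGridCell f g M N) {i j : Fin k} (hij : i ≤ j)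
    (hf : f H.top + (k - 1 - j) ≤ fst f b) (hg : g H.top + i ≤ snd g b) : inner i j hij ≤ b := by
  cases b with
  | old y => exact c.le_old_of_coordinates_le hf hg
  | onLeft e' he' i' =>
    obtain ⟨l, hl, -, -, h₁, h₂⟩ := c.exists_isRowEdge_of_mem_leftEdges he'
    simp only [snd] at hg
    omega
  | onRight e' he' i' =>
    obtain ⟨l, hl, -, -, h₁, h₂⟩ := c.exists_isRowEdge_of_mem_rightEdges he'
    simp only [fst] at hf
    omega
  | inner i' j' hij' =>
    simp only [fst, snd] at hf hg
    exact (Step.inner_inner i j i' j' hij hij' (by omega) (by omega)).le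

theorem multifork_le_iff (c : H.IsGridCell f g M N) :
    a ≤ b ↔ fst f a ≤ fst f b ∧ snd g a ≤ snd g b := by
  refine ⟨c.coordinates_le_of_le, fun ⟨hf, hg⟩ => ?_⟩
  cases a with
  | old x => exact c.old_le_of_coordinates_le hf hg
  | onLeft e he i => exact c.onLeft_le_of_coordinates_le he i hf hg
  | onRight e he i => exact c.onRight_le_of_coordinates_le he i hf hg
  | inner i j hij => exact c.inner_le_of_coordinates_le hij hf hg

end IsGridCell

end FourCell

/-! ### Staircase extensions of grids -/

/-- The points of the grid, with `k` new columns inserted before the `m`-th column and `k` new rows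
inserted before the `n`-th row, that lie on or below the staircase formed by the maximal new
elements of the multifork extension. -/
def IsBelowStaircase (m n k p q : ℕ) : Prop :=
  p < m + k ∧ q < n + k ∧ (p + 1 - m) + (q + 1 - n) ≤ k + 1

namespace IsBelowStaircase

variable {m n k p q : ℕ}

theorem swap (h : IsBelowStaircase m n k p q) : IsBelowStaircase n m k q p := by
  obtain ⟨hp, hq, hpq⟩ := h
  exact ⟨hq, hp, by omega⟩

theorem mono (h : IsBelowStaircase m n k p q) {p' q' : ℕ} (hp' : p' ≤ p) (hq' : q' ≤ q) :
    IsBelowStaircase m n k p' q' := by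
  obtain ⟨hp, hq, hpq⟩ := h
  exact ⟨by omega, by omega, by omega⟩

end IsBelowStaircase

/-- The poset `P` arises from `L`, which has grid coordinates `f` and `g`, by inserting `k` columns
and `k` rows before the column and the row of `t` and adding all points below the staircase. -/
structure IsStaircaseExtension {L P : Type*} [PartialOrder L] [PartialOrder P] (ι : L → P)
    (f g : L → ℕ) (F G : P → ℕ) (M N : ℕ) (t : L) (k : ℕ) : Prop where
  grid : IsGridCoordinates f g M N
  fst_top_pos : 0 < f t
  snd_top_pos : 0 < g t
  isFullBelow : IsFullBelow f g t
  le_iff : ∀ {a b : P}, a ≤ b ↔ F a ≤ F b ∧ G a ≤ G b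
  fst_old : ∀ x, F (ι x) = gridShift (f t) k (f x)
  snd_old : ∀ x, G (ι x) = gridShift (g t) k (g x)
  exists_of_isBelowStaircase : ∀ {p q}, IsBelowStaircase (f t) (g t) k p q → ∃ a, F a = p ∧ G a = q
  isBelowStaircase_or_old : ∀ a, IsBelowStaircase (f t) (g t) k (F a) (G a) ∨ ∃ x, ι x = a

namespace IsStaircaseExtension

variable {L P : Type*} [PartialOrder L] [PartialOrder P] {ι : L → P} {f g : L → ℕ} {F G : P → ℕ}
  {M N k : ℕ} {t : L}

theorem swap (s : IsStaircaseExtension ι f g F G M N t k) :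
    IsStaircaseExtension ι g f G F N M t k where
  grid := s.grid.swap
  fst_top_pos := s.snd_top_pos
  snd_top_pos := s.fst_top_pos
  isFullBelow := s.isFullBelow.swap
  le_iff := s.le_iff.trans and_comm
  fst_old := s.snd_old
  snd_old := s.fst_old
  exists_of_isBelowStaircase h := (s.exists_of_isBelowStaircase h.swap).imp fun _ => And.symm
  isBelowStaircase_or_old a := (s.isBelowStaircase_or_old a).imp_left IsBelowStaircase.swap

theorem old_le_old_iff (s : IsStaircaseExtension ι f g F G M N t k) {x y : L} :
    ι x ≤ ι y ↔ x ≤ y := by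
  rw [s.le_iff, s.grid.le_iff, s.fst_old, s.snd_old, s.fst_old, s.snd_old,
    (gridShift_strictMono _ k).le_iff_le, (gridShift_strictMono _ k).le_iff_le]

theorem fst_old_of_le (s : IsStaircaseExtension ι f g F G M N t k) {x : L} (h : f t ≤ f x) :
    F (ι x) = f x + k := by
  rw [s.fst_old, gridShift_of_le h]

theorem snd_old_of_lt (s : IsStaircaseExtension ι f g F G M N t k) {x : L} (h : g x < g t) :
    G (ι x) = g x := by
  rw [s.snd_old, gridShift_of_lt h]

theorem fst_old_lt_or_le (s : IsStaircaseExtension ι f g F G M N t k) (x : L) :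
    F (ι x) < f t ∨ f t + k ≤ F (ι x) := by
  rw [s.fst_old, gridShift]
  split_ifs <;> omega

theorem exists_fst (s : IsStaircaseExtension ι f g F G M N t k) (i : ℕ) (hi : i ≤ M + k) :
    ∃ a, F a = i ∧ G a = 0 := by
  have hpos := s.snd_top_pos
  rcases lt_or_ge i (f t + k) with hlt | hge
  · exact s.exists_of_isBelowStaircase ⟨hlt, by omega, by omega⟩
  · obtain ⟨x, hxf, hxg⟩ := s.grid.exists_fst (i - k) (by omega)
    exact ⟨ι x, by rw [s.fst_old_of_le] <;> omega, by rw [s.snd_old_of_lt] <;> omega⟩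

theorem le_fst (s : IsStaircaseExtension ι f g F G M N t k) (a : P) : F a ≤ M + k := by
  rcases s.isBelowStaircase_or_old a with ha | ⟨x, rfl⟩
  · have := s.grid.le_fst t
    have := ha.1
    omega
  · rw [← gridShift_of_le (s.grid.le_fst t), s.fst_old]
    exact (gridShift_strictMono _ k).monotone (s.grid.le_fst x)

theorem exists_inf (s : IsStaircaseExtension ι f g F G M N t k) (a b : P) :
    ∃ c, F c = min (F a) (F b) ∧ G c = min (G a) (G b) := by
  rcases s.isBelowStaircase_or_old a with ha | ⟨x, rfl⟩
  · exact s.exists_of_isBelowStaircase (ha.mono (min_le_left _ _) (min_le_left _ _))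
  rcases s.isBelowStaircase_or_old b with hb | ⟨y, rfl⟩
  · exact s.exists_of_isBelowStaircase (hb.mono (min_le_right _ _) (min_le_right _ _))
  obtain ⟨z, hzf, hzg⟩ := s.grid.exists_inf x y
  refine ⟨ι z, ?_, ?_⟩
  · rw [s.fst_old, s.fst_old, s.fst_old, hzf, (gridShift_strictMono _ k).monotone.map_min]
  · rw [s.snd_old, s.snd_old, s.snd_old, hzg, (gridShift_strictMono _ k).monotone.map_min]

theorem exists_right_of_isBelowStaircase (s : IsStaircaseExtension ι f g F G M N t k) {a b : P}
    (ha : IsBelowStaircase (f t) (g t) k (F a) (G a)) (hF : F a = F b) (hG : G a < G b) :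
    ∃ c, F a < F c ∧ G a ≤ G c ∧ G c < G b := by
  by_cases hnext : IsBelowStaircase (f t) (g t) k (F a + 1) (G a)
  · obtain ⟨c, hcF, hcG⟩ := s.exists_of_isBelowStaircase hnext
    exact ⟨c, by omega, by omega, by omega⟩
  obtain ⟨haF, haG, hsum⟩ := ha
  rcases lt_or_ge (G a) (g t) with hlt | hge
  · obtain ⟨x, hxf, hxg⟩ := s.isFullBelow (f t) le_rfl (G a) hlt.le
    have hxF := s.fst_old_of_le hxf.ge
    have hxG := s.snd_old_of_lt (hxg.trans_lt hlt)
    exact ⟨ι x, by omega, by omega, by omega⟩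
  · unfold IsBelowStaircase at hnext
    rcases s.isBelowStaircase_or_old b with ⟨-, -, hb⟩ | ⟨y, rfl⟩
    · omega
    · have := s.fst_old_lt_or_le y
      omega

theorem exists_right (s : IsStaircaseExtension ι f g F G M N t k) {a b : P} (hF : F a = F b)
    (hG : G a < G b) (ha : F a < M + k) : ∃ c, F a < F c ∧ G a ≤ G c ∧ G c < G b := by
  by_cases hstair : IsBelowStaircase (f t) (g t) k (F a) (G a)
  · exact s.exists_right_of_isBelowStaircase hstair hF hG
  obtain ⟨x, rfl⟩ := (s.isBelowStaircase_or_old a).resolve_left hstair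
  obtain ⟨y, rfl⟩ := (s.isBelowStaircase_or_old b).resolve_left
    fun hb => hstair (hb.mono hF.le hG.le)
  simp only [s.fst_old, s.snd_old] at hF hG ha
  rw [← gridShift_of_le (s.grid.le_fst t)] at ha
  obtain ⟨w, hw₁, hw₂, hw₃⟩ := s.grid.exists_right ((gridShift_strictMono _ k).injective hF)
    ((gridShift_strictMono _ k).lt_iff_lt.1 hG) ((gridShift_strictMono _ k).lt_iff_lt.1 ha)
  refine ⟨ι w, ?_⟩
  rw [s.fst_old, s.fst_old, s.snd_old, s.snd_old, s.snd_old]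
  exact ⟨gridShift_strictMono _ k hw₁, (gridShift_strictMono _ k).monotone hw₂,
    gridShift_strictMono _ k hw₃⟩

theorem isGridCoordinates (s : IsStaircaseExtension ι f g F G M N t k) :
    IsGridCoordinates F G (M + k) (N + k) where
  pos_fst := Nat.add_pos_left s.grid.pos_fst k
  pos_snd := Nat.add_pos_left s.grid.pos_snd k
  le_iff := s.le_iff
  exists_inf := s.exists_inf
  exists_top := by
    obtain ⟨x, hxf, hxg⟩ := s.grid.exists_top
    refine ⟨ι x, ?_, ?_⟩
    · rw [s.fst_old_of_le (by rw [hxf]; exact s.grid.le_fst t), hxf]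
    · rw [s.swap.fst_old_of_le (by rw [hxg]; exact s.grid.le_snd t), hxg]
  le_fst := s.le_fst
  le_snd := s.swap.le_fst
  exists_fst := s.exists_fst
  exists_snd i hi := (s.swap.exists_fst i hi).imp fun _ => And.symm
  exists_right := s.exists_right
  exists_above := s.swap.exists_right

theorem coheight_old (s : IsStaircaseExtension ι f g F G M N t k) {x : L} (hx : f t ≤ f x) :
    Order.coheight (ι x) = Order.coheight x := by
  let φ : Set.Ici x ↪o Set.Ici (ι x) :=
    OrderEmbedding.ofMapLEIff (fun y => ⟨ι y, s.old_le_old_iff.2 y.2⟩) fun _ _ => s.old_le_old_iff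
  have hφ : Function.Surjective φ := by
    rintro ⟨a, ha⟩
    rcases s.isBelowStaircase_or_old a with ⟨haF, -, -⟩ | ⟨y, rfl⟩
    · have hle := (s.le_iff.1 ha).1
      rw [s.fst_old_of_le hx] at hle
      omega
    · exact ⟨⟨y, s.old_le_old_iff.1 ha⟩, rfl⟩
  have hdim := Order.krullDim_eq_of_orderIso (RelIso.ofSurjective φ hφ)
  rw [← Order.coheight_eq_krullDim_Ici, ← Order.coheight_eq_krullDim_Ici] at hdim
  exact (WithBot.coe_inj.1 hdim).symm

theorem krullDim_eq_add (s : IsStaircaseExtension ι f g F G M N t k) :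
    Order.krullDim P = Order.krullDim L + k := by
  obtain ⟨x, hxf, hxg⟩ := s.grid.exists_fst (f t) (s.grid.le_fst t)
  have hxG : G (ι x) = 0 := by rw [s.snd_old_of_lt (hxg.trans_lt s.snd_top_pos), hxg]
  rw [s.grid.krullDim_eq hxg, s.isGridCoordinates.krullDim_eq hxG, s.coheight_old hxf.ge,
    s.fst_old_of_le hxf.ge]
  push_cast
  rw [add_assoc]

end IsStaircaseExtension

namespace FourCell

namespace IsGridCell

open MultiforkExtension

variable {L : Type*} [Lattice L] {H : FourCell L} {f g : L → ℕ} {M N : ℕ}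

theorem exists_multifork_of_isBelowStaircase (c : H.IsGridCell f g M N) {k p q : ℕ}
    (h : IsBelowStaircase (f H.top) (g H.top) k p q) :
    ∃ a : MultiforkExtension H k, fst f a = p ∧ snd g a = q := by
  obtain ⟨hp, hq, hpq⟩ := h
  rcases lt_or_ge p (f H.top) with hpf | hpf <;> rcases lt_or_ge q (g H.top) with hqg | hqg
  · obtain ⟨x, rfl, rfl⟩ := c.isFullBelow p hpf.le q hqg.le
    exact ⟨old x, gridShift_of_lt hpf, gridShift_of_lt hqg⟩
  · obtain ⟨e, he⟩ := c.flip.isFullBelow.exists_isRowEdge c.flip.fst_top_pos hpf.le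
    refine ⟨onRight e (c.mem_rightEdges_of_isRowEdge hpf he) ⟨q - g H.top, by omega⟩,
      he.snd_upper, ?_⟩
    simp only [snd]
    omega
  · obtain ⟨e, he⟩ := c.isFullBelow.exists_isRowEdge c.fst_top_pos hqg.le
    refine ⟨onLeft e (c.mem_leftEdges_of_isRowEdge hqg he) ⟨k - 1 - (p - f H.top), by omega⟩,
      ?_, he.snd_upper⟩
    simp only [fst]
    omega
  · refine ⟨inner ⟨q - g H.top, by omega⟩ ⟨k - 1 - (p - f H.top), by omega⟩
      (Fin.mk_le_mk.2 (by omega)), ?_, ?_⟩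
    · simp only [fst]
      omega
    · simp only [snd]
      omega

theorem isBelowStaircase_or_old (c : H.IsGridCell f g M N) {k : ℕ} (a : MultiforkExtension H k) :
    IsBelowStaircase (f H.top) (g H.top) k (fst f a) (snd g a) ∨ ∃ x, old x = a := by
  cases a with
  | old x => exact Or.inr ⟨x, rfl⟩
  | onLeft e he i =>
    obtain ⟨j, hj, -, -, h₁, h₂⟩ := c.exists_isRowEdge_of_mem_leftEdges he
    left
    simp only [IsBelowStaircase, fst, snd]
    omega
  | onRight e he i =>
    obtain ⟨j, hj, -, -, h₁, h₂⟩ := c.exists_isRowEdge_of_mem_rightEdges he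
    left
    simp only [IsBelowStaircase, fst, snd]
    omega
  | inner i j hij =>
    left
    simp only [IsBelowStaircase, fst, snd]
    omega

theorem isStaircaseExtension (c : H.IsGridCell f g M N) (k : ℕ) :
    IsStaircaseExtension (old : L → MultiforkExtension H k) f g (fst f) (snd g) M N H.top k where
  grid := c.toIsGridCoordinates
  fst_top_pos := c.fst_top_pos
  snd_top_pos := c.flip.fst_top_pos
  isFullBelow := c.isFullBelow
  le_iff := c.multifork_le_iff
  fst_old _ := rfl
  snd_old _ := rfl
  exists_of_isBelowStaircase := c.exists_multifork_of_isBelowStaircase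
  isBelowStaircase_or_old := c.isBelowStaircase_or_old

end IsGridCell

end FourCell

/-! ### Cardinality -/

theorem card_setOf_fst_le_snd (α : Type*) [LinearOrder α] [Fintype α] :
    Nat.card {p : α × α // p.1 ≤ p.2} = Fintype.card α * (Fintype.card α + 1) / 2 := by
  rw [← Nat.card_congr Sym2.sortEquiv, Nat.card_eq_fintype_card, Sym2.card, Nat.choose_two_right,
    Nat.add_sub_cancel, mul_comm]

namespace FourCell

open MultiforkExtension

variable {L : Type*} [Lattice L] {H : FourCell L} {k : ℕ}

/-- The elements of the multifork extension, sorted by their constructors. -/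
def MultiforkExtension.equivSum : MultiforkExtension H k ≃
    L ⊕ (H.leftEdges × Fin k) ⊕ (H.rightEdges × Fin k) ⊕ {p : Fin k × Fin k // p.1 ≤ p.2} where
  toFun
    | old x => .inl x
    | onLeft e he i => .inr (.inl (⟨e, he⟩, i))
    | onRight e he i => .inr (.inr (.inl (⟨e, he⟩, i)))
    | inner i j hij => .inr (.inr (.inr ⟨(i, j), hij⟩))
  invFun
    | .inl x => old x
    | .inr (.inl (e, i)) => onLeft e.1 e.2 i
    | .inr (.inr (.inl (e, i))) => onRight e.1 e.2 i
    | .inr (.inr (.inr p)) => inner p.1.1 p.1.2 p.2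
  left_inv a := by cases a <;> rfl
  right_inv a := by rcases a with x | ⟨e, i⟩ | ⟨e, i⟩ | p <;> rfl

theorem IsGridCell.card_multifork {f g : L → ℕ} {M N : ℕ} (c : H.IsGridCell f g M N) (k : ℕ) :
    ENat.card (H.MultiforkExtension k) =
      ENat.card L + k * Order.height H.top + ((k * (k + 1) / 2 : ℕ) : ℕ∞) := by
  have := c.finite
  have : Finite (H.MultiforkExtension k) := .of_equiv _ equivSum.symm
  rw [c.isFullBelow.height_eq c.toIsGridCoordinates, ENat.card_eq_coe_natCard,
    ENat.card_eq_coe_natCard, Nat.card_congr equivSum, Nat.card_sum, Nat.card_sum, Nat.card_sum,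
    Nat.card_prod, Nat.card_prod, card_setOf_fst_le_snd, Nat.card_coe_set_eq, Nat.card_coe_set_eq,
    c.ncard_leftEdges, c.ncard_rightEdges, Nat.card_fin, Fintype.card_fin]
  norm_cast
  ring

end FourCell

theorem lemma2p4 {L : Type*} [Lattice L] (hL : IsSlimRectangular L) (H : FourCell L)
    (hH : H.IsDistributive) (k : ℕ) (hk : 0 < k) :
    (∃ inst : Lattice (H.MultiforkExtension k),
      inst.toSemilatticeSup.toPartialOrder =
          (inferInstance : PartialOrder (H.MultiforkExtension k)) ∧
        @IsSlimRectangular (H.MultiforkExtension k) inst) ∧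
    ENat.card (H.MultiforkExtension k) =
      ENat.card L + k * Order.height H.top + ((k * (k + 1) / 2 : ℕ) : ℕ∞) ∧
    Order.krullDim (H.MultiforkExtension k) = Order.krullDim L + k := by
  obtain ⟨f, g, M, N, c⟩ := H.exists_isGridCell hL hH
  have s := c.isStaircaseExtension k
  exact ⟨s.isGridCoordinates.exists_lattice_isSlimRectangular, c.card_multifork k,
    s.krullDim_eq_add⟩
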